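/- Let $X$ be a smooth projective curve over $\mathbb{C}$, that is, a nonempty projective $\mathbb{C}$-scheme which is smooth of relative dimension $1$ over $\mathbb{C}$ (connectedness is not needed), and let $n\ge 1$ be an integer. Let $$\mathcal{F}_X^n:\ \mathrm{Sch}_{\mathbb{C}}^{op}\longrightarrow \mathrm{Sets}$$ be the moduli functor that sends a $\mathbb{C}$-scheme $U$ to the set of isomorphism classes of vector bundles of rank $n$ (locally free sheaves of rank $n$) on $U\times_{\operatorname{Spec}\mathbb{C}}X$, and a morphism $f:U\to V$ of $\mathbb{C}$-schemes to the map $[E]\mapsto[(f\times \mathrm{id}_X)^*E]$. Then $\mathcal{F}_X^n$ is not representable in $\mathrm{Sch}_{\mathbb{C}}$: there is no $\mathbb{C}$-scheme $M$ with a natural isomorphism $\mathcal{F}_X^n\cong \mathrm{Hom}_{\mathrm{Sch}_{\mathbb{C}}}(-,M)$. -/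

import Mathlib

open CategoryTheory AlgebraicGeometry

noncomputable section

/-! ### Smooth projective curves over `ℂ` -/

/-- The category of schemes over `ℂ`. -/
abbrev SchC : Type 1 := Over (Spec (CommRingCat.of ℂ))

/-- Projective space `ℙ^N` over `ℂ`, as `Proj ℂ[x₀, …, x_N]` with its structure morphism
to `Spec ℂ`. -/
def projectiveSpaceC (N : ℕ) : SchC :=
  letI : GradedAlgebra (MvPolynomial.homogeneousSubmodule (Fin (N + 1)) ℂ) :=
    MvPolynomial.gradedAlgebra
  Over.mk (Proj.toSpecZero (MvPolynomial.homogeneousSubmodule (Fin (N + 1)) ℂ) ≫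
    Spec.map (CommRingCat.ofHom
      (algebraMap ℂ (MvPolynomial.homogeneousSubmodule (Fin (N + 1)) ℂ 0))))

/-- A `ℂ`-scheme is projective if it admits a closed immersion over `ℂ` into some `ℙ^N`. -/
def IsProjectiveC (X : SchC) : Prop :=
  ∃ (N : ℕ) (i : X ⟶ projectiveSpaceC N), IsClosedImmersion i.left

/-- A smooth projective curve over `ℂ`: a nonempty projective `ℂ`-scheme, smooth of relative
dimension one over `ℂ`.  Connectedness is not required. -/
structure IsSmoothProjectiveCurve (X : SchC) : Prop where
  nonempty : Nonempty X.left
  smooth : SmoothOfRelativeDimension 1 X.hom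
  projective : IsProjectiveC X

/-! ### Vector bundles of rank `n` on a scheme -/

/-- The free `𝒪_Y`-module `𝒪_Y^n`. -/
def freeModule (Y : Scheme.{0}) (n : ℕ) : Y.Modules :=
  SheafOfModules.free (R := Y.ringCatSheaf) (Fin n)

/-- An `𝒪_Y`-module is (the sheaf of sections of) a vector bundle of rank `n` if every point
of `Y` has an open neighbourhood `U` on which it is isomorphic to `𝒪_U^n`. -/
def IsVectorBundle (n : ℕ) (Y : Scheme.{0}) : ObjectProperty Y.Modules := fun M =>
  ∀ y : Y, ∃ U : Y.Opens, y ∈ U ∧ Nonempty (M.restrict U.ι ≅ freeModule U n)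

/-- The category of vector bundles of rank `n` on `Y`, with all `𝒪_Y`-linear maps. -/
abbrev VectBundle (n : ℕ) (Y : Scheme.{0}) : Type 1 := (IsVectorBundle n Y).FullSubcategory

instance opensMap_final {Y Z : Scheme.{0}} (f : Y ⟶ Z) :
    (TopologicalSpace.Opens.map f.base).Final where
  out V := by
    let T : StructuredArrow V (TopologicalSpace.Opens.map f.base) :=
      StructuredArrow.mk (Y := (⊤ : Z.Opens)) (homOfLE (fun _ _ => trivial))
    have hT : Limits.IsTerminal T := Limits.IsTerminal.ofUniqueHom
      (fun W => StructuredArrow.homMk (homOfLE le_top) (Subsingleton.elim _ _))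
      (fun W m => by ext; exact Subsingleton.elim _ _)
    have : Limits.HasTerminal (StructuredArrow V (TopologicalSpace.Opens.map f.base)) :=
      hT.hasTerminal
    exact isConnected_of_hasTerminal _

instance modulesPushforward_isRightAdjoint {Y Z : Scheme.{0}} (f : Y ⟶ Z) :
    (SheafOfModules.pushforward.{0} f.toRingCatSheafHom).IsRightAdjoint :=
  (Scheme.Modules.pullbackPushforwardAdjunction f).isRightAdjoint

/-- The pullback of `𝒪^n` is `𝒪^n`. -/
def pullbackFreeModule {Y Z : Scheme.{0}} (f : Y ⟶ Z) (n : ℕ) :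
    (Scheme.Modules.pullback f).obj (freeModule Z n) ≅ freeModule Y n :=
  SheafOfModules.pullbackObjFreeIso f.toRingCatSheafHom (Fin n)

/-- The pullback of a vector bundle of rank `n` is a vector bundle of rank `n`. -/
theorem IsVectorBundle.pullback {n : ℕ} {Y Z : Scheme.{0}} (f : Y ⟶ Z) {M : Z.Modules}
    (hM : IsVectorBundle n Z M) :
    IsVectorBundle n Y ((Scheme.Modules.pullback f).obj M) := by
  intro y
  obtain ⟨U, hU, ⟨e⟩⟩ := hM (f y)
  refine ⟨f ⁻¹ᵁ U, hU, ⟨?_⟩⟩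
  exact (Scheme.Modules.restrictFunctorIsoPullback (f ⁻¹ᵁ U).ι).app _ ≪≫
    (Scheme.Modules.pullbackComp (f ⁻¹ᵁ U).ι f).app M ≪≫
    (Scheme.Modules.pullbackCongr (morphismRestrict_ι f U).symm).app M ≪≫
    ((Scheme.Modules.pullbackComp (f ∣_ U) U.ι).app M).symm ≪≫
    (Scheme.Modules.pullback (f ∣_ U)).mapIso
      (((Scheme.Modules.restrictFunctorIsoPullback U.ι).app M).symm ≪≫ e) ≪≫
    pullbackFreeModule (f ∣_ U) n

/-- The pullback of vector bundles of rank `n` along a morphism of schemes. -/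
def VectBundle.pullback (n : ℕ) {Y Z : Scheme.{0}} (f : Y ⟶ Z) :
    VectBundle n Z ⥤ VectBundle n Y :=
  ObjectProperty.lift _ ((IsVectorBundle n Z).ι ⋙ Scheme.Modules.pullback f)
    (fun M => IsVectorBundle.pullback f M.property)

/-- The contravariant functor sending a scheme `Y` to the set of isomorphism classes of vector
bundles of rank `n` on `Y`, and a morphism to the pullback of vector bundles along it. -/
def vectBundleClasses (n : ℕ) : Scheme.{0}ᵒᵖ ⥤ Type 1 where
  obj Y := Quotient (isIsomorphicSetoid (VectBundle n Y.unop))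
  map f := ↾(Quotient.map (VectBundle.pullback n f.unop).obj
    (fun _ _ ⟨e⟩ => ⟨(VectBundle.pullback n f.unop).mapIso e⟩))
  map_id Y := by
    ext E
    induction E using Quotient.inductionOn with | h E =>
    exact Quotient.sound ⟨ObjectProperty.isoMk _
      ((Scheme.Modules.pullbackId Y.unop).app E.obj)⟩
  map_comp f g := by
    ext E
    induction E using Quotient.inductionOn with | h E =>
    exact Quotient.sound ⟨ObjectProperty.isoMk _
      ((Scheme.Modules.pullbackComp g.unop f.unop).app E.obj).symm⟩

/-! ### The moduli functor -/

/-- The functor `U ↦ U ×_ℂ X`, `f ↦ f × id_X`, from `ℂ`-schemes to schemes. -/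
def prodWith (X : SchC) : SchC ⥤ Scheme.{0} :=
  Over.pullback X.hom ⋙ Over.forget X.left

/-- The moduli functor of vector bundles of rank `n` on `X`: it sends a `ℂ`-scheme `U` to the set
of isomorphism classes of vector bundles of rank `n` on `U ×_ℂ X`, and a morphism `f` to the
pullback along `f × id_X`. -/
def moduliFunctor (X : SchC) (n : ℕ) : SchCᵒᵖ ⥤ Type 1 :=
  (prodWith X).op ⋙ vectBundleClasses n

end

/-! A morphism to a scheme is determined Zariski-locally, whereas an isomorphism class of bundles is
not. If `M` represents the functor and `E` is a bundle on `U`, the pullbacks to `U ×_ℂ X` of `E` and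
of the trivial bundle are classified by morphisms `U ⟶ M` that agree wherever `E` is trivial. So the
morphisms are equal, and restricting along the graph of a morphism `U ⟶ X` makes `E` itself trivial
(`nonempty_iso_freeModule_of_representableBy`). It remains to find a nontrivial `E` on some scheme
over `X`. Over the residue field of a point of `X`, let `R` be the coordinate ring of `y² + y = x³`
and `I` the ideal of the origin: `I × R^(n-1)` is locally free, and it is not free, by a determinant
argument (`exists_nontrivial_vectorBundle`). -/

/-! ### Commutative algebra: a locally principal ideal that is not principal. -/

/-- If `I × R^k` is free of rank `k + 1`, then the ideal `I` is principal. -/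
theorem Ideal.isPrincipal_of_prod_equiv {R : Type*} [CommRing R] (I : Ideal R) {k : ℕ}
    (e : (Fin (k + 1) → R) ≃ₗ[R] I × (Fin k → R)) : I.IsPrincipal := by
  let ι : I × (Fin k → R) →ₗ[R] (Fin (k + 1) → R) :=
    { toFun := fun p => Fin.cons (p.1 : R) p.2
      map_add' := fun p q => by ext i; refine Fin.cases ?_ (fun _ => ?_) i <;> simp
      map_smul' := fun r p => by ext i; refine Fin.cases ?_ (fun _ => ?_) i <;> simp }
  have hι : ∀ p, ι p = Fin.cons (p.1 : R) p.2 := fun _ => rfl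
  -- `A` is an endomorphism of `R^(k+1)` with image `I × R^k`; its determinant will generate `I`.
  set A := ι ∘ₗ e.toLinearMap with hA
  refine ⟨⟨LinearMap.det A, le_antisymm (fun a ha => ?_) ?_⟩⟩
  -- For `a ∈ I`, the matrix `diag(a, 1, …, 1)` factors through `A`, so `det A` divides `a`.
  · let m : (Fin (k + 1) → R) →ₗ[R] I × (Fin k → R) :=
      { toFun := fun v => (v 0 • ⟨a, ha⟩, Fin.tail v)
        map_add' := fun v w => by ext <;> simp [Fin.tail, add_mul]
        map_smul' := fun r v => by ext <;> simp [Fin.tail, mul_assoc] }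
    have hm : ι ∘ₗ m = A ∘ₗ (e.symm.toLinearMap ∘ₗ m) := by
      ext v : 2; simp [hA]
    have hdet : LinearMap.det (ι ∘ₗ m) = a := by
      have : ι ∘ₗ m = Matrix.toLin' (Matrix.diagonal (Fin.cons a fun _ => 1)) := by
        refine LinearMap.ext fun v => funext fun i => ?_
        rw [Matrix.toLin'_apply, Matrix.mulVec_diagonal, LinearMap.comp_apply, hι]
        refine Fin.cases ?_ (fun _ => ?_) i <;> simp [m, Fin.tail, mul_comm]
      rw [this, LinearMap.det_toLin', Matrix.det_diagonal, Fin.prod_univ_succ]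
      simp
    rw [← hdet, hm, LinearMap.det_comp]
    exact Submodule.mem_span_singleton.mpr ⟨_, mul_comm _ _⟩
  -- The first row of `A` has its entries in `I`; expand the determinant along it.
  · rw [Submodule.span_singleton_le_iff_mem, ← LinearMap.det_toMatrix', Matrix.det_succ_row_zero]
    refine Ideal.sum_mem _ fun j _ => Ideal.mul_mem_right _ _ (Ideal.mul_mem_left _ _ ?_)
    rw [LinearMap.toMatrix'_apply]
    simp [hA, hι]

/-- If `I * J` is generated by a nonzero element, then `I` is locally isomorphic to the ring:
near every prime there are maps in both directions, inverse to each other up to a factor that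
does not vanish there. -/
theorem Ideal.exists_almost_inverse_of_mul_eq_span {R : Type*} [CommRing R] [IsDomain R]
    {I J : Ideal R} {c : R} (hc : c ≠ 0) (hIJ : I * J = Ideal.span {c}) (P : Ideal R)
    (hP : P ≠ ⊤) :
    ∃ f ∉ P, ∃ (g : R →ₗ[R] I) (h : I →ₗ[R] R), (∀ r, h (g r) = f * r) ∧ ∀ x, g (h x) = f • x := by
  have hdiv : ∀ a ∈ I, ∀ b ∈ J, ∃ r, c * r = a * b := fun a ha b hb => by
    obtain ⟨r, hr⟩ := Ideal.mem_span_singleton'.mp (hIJ ▸ Ideal.mul_mem_mul ha hb)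
    exact ⟨r, by rw [mul_comm, hr]⟩
  -- If all quotients `ab / c` lay in `P`, then `(c) = IJ ⊆ cP`, which forces `1 ∈ P`.
  obtain ⟨a, ha, b, hb, f, hf, hab⟩ :
      ∃ a ∈ I, ∃ b ∈ J, ∃ f ∉ P, c * f = a * b := by
    by_contra! H
    refine hP ((Ideal.eq_top_iff_one _).mpr ?_)
    have hle : I * J ≤ Ideal.span {c} * P := Ideal.mul_le.mpr fun a ha b hb => by
      obtain ⟨r, hr⟩ := hdiv a ha b hb
      have hrP : r ∈ P := by
        by_contra h
        exact H a ha b hb r h hr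
      exact Ideal.mem_span_singleton_mul.mpr ⟨r, hrP, hr⟩
    rw [hIJ, Ideal.span_singleton_le_iff_mem] at hle
    obtain ⟨z, hz, hcz⟩ := Ideal.mem_span_singleton_mul.mp hle
    rwa [mul_right_eq_self₀.mp hcz |>.resolve_right hc] at hz
  -- The two maps are `r ↦ ra` and `x ↦ xb / c`.
  choose h hh using fun x : I => hdiv x x.2 b hb
  refine ⟨f, hf, LinearMap.toSpanSingleton R I ⟨a, ha⟩,
    { toFun := h
      map_add' := fun x y => mul_left_cancel₀ hc ?_
      map_smul' := fun r x => mul_left_cancel₀ hc ?_ }, fun r => mul_left_cancel₀ hc ?_,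
      fun x => Subtype.ext (mul_left_cancel₀ hc ?_)⟩
  · rw [mul_add, hh, hh, hh]; simp [add_mul]
  · rw [hh, RingHom.id_apply, smul_eq_mul, mul_left_comm, hh]; simp [mul_assoc]
  · simp only [LinearMap.toSpanSingleton_apply, LinearMap.coe_mk, AddHom.coe_mk]
    rw [hh, ← mul_assoc, hab]
    simp only [smul_eq_mul, SetLike.val_smul]
    ring
  · simp only [LinearMap.toSpanSingleton_apply, LinearMap.coe_mk, AddHom.coe_mk,
      SetLike.val_smul, smul_eq_mul]
    rw [← mul_assoc, hh, ← mul_assoc, hab]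
    ring

open WeierstrassCurve.Affine in
/-- The ideal of a nonsingular point of a Weierstrass curve is not principal. -/
theorem WeierstrassCurve.Affine.CoordinateRing.not_isPrincipal_XYIdeal {F : Type*} [Field F]
    {W : WeierstrassCurve.Affine F} {x y : F} (h : W.Nonsingular x y) :
    ¬ (CoordinateRing.XYIdeal W x (Polynomial.C y)).IsPrincipal := by
  classical
  intro hI
  -- Only the point at infinity has trivial ideal class.
  have h0 := (Point.toClass_eq_zero (Point.some x y h)).not.mpr (by simp)
  refine h0 ?_
  rw [Point.toClass_some]
  refine ClassGroup.mk_eq_one_iff.mpr ?_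
  rw [CoordinateRing.XYIdeal'_eq]
  obtain ⟨a, ha⟩ := hI
  rw [ha]
  refine ⟨algebraMap _ _ a, ?_⟩
  ext z
  simp [Submodule.mem_span_singleton]

/-- Every field `K` has a domain over it with a nonprincipal ideal that divides a nonzero
principal one. -/
theorem exists_not_isPrincipal_and_mul_eq_span (K : Type) [Field K] :
    ∃ (R : Type) (_ : CommRing R) (_ : IsDomain R) (_ : Algebra K R) (I J : Ideal R) (c : R),
      c ≠ 0 ∧ I * J = Ideal.span {c} ∧ ¬ I.IsPrincipal := by
  -- On `y² + y = x³` the `y`-derivative at the origin is `1` in every characteristic. `J` is the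
  -- ideal of the negated point and `c` is the function `x`.
  let W : WeierstrassCurve.Affine K := ⟨0, 0, 1, 0, 0⟩
  have h : W.Nonsingular 0 0 := by
    rw [WeierstrassCurve.Affine.nonsingular_zero]
    simp [W]
  exact ⟨W.CoordinateRing, inferInstance, inferInstance, inferInstance, _, _, _,
    WeierstrassCurve.Affine.CoordinateRing.XClass_ne_zero 0,
    (mul_comm _ _).trans (WeierstrassCurve.Affine.CoordinateRing.XYIdeal_neg_mul h),
    WeierstrassCurve.Affine.CoordinateRing.not_isPrincipal_XYIdeal h⟩

/-! ### From modules to sheaves on an affine scheme. -/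

namespace AlgebraicGeometry

variable {R : CommRingCat.{0}}

/-- The map of sheaves induced by multiplication by `f` is multiplication by `f` on sections. -/
theorem tilde.map_smul_id_app_apply {M : ModuleCat.{0} R} (f : R) (U : (Spec R).Opens)
    (x : Γ(tilde M, U)) : (tilde.map (f • 𝟙 M)).app U x = f • x := by
  -- By fullness, multiplication by `f` on the sheaf comes from a module map, which global sections
  -- identify.
  let μ : tilde M ⟶ tilde M := SpecModulesToSheafFullyFaithful.preimage
    ⟨{ app := fun V => f • 𝟙 ((modulesSpecToSheaf.obj (tilde M)).presheaf.obj V)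
       naturality := fun V W i => by
        rw [Linear.comp_smul, Linear.smul_comp, Category.id_comp]
        erw [Category.comp_id] }⟩
  obtain ⟨ψ, hψ⟩ := (tilde.functor R).map_surjective μ
  have hψf : ψ = f • 𝟙 M := by
    ext m
    refine ((ConcreteCategory.isIso_iff_bijective (tilde.toOpen M ⊤)).mp inferInstance).1 ?_
    have h := ConcreteCategory.congr_hom (tilde.toOpen_map_app ψ ⊤) m
    refine h.symm.trans ?_
    have hμ : modulesSpecToSheaf.map (tilde.map ψ) = modulesSpecToSheaf.map μ := by rw [← hψ]; rfl
    rw [hμ]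
    exact ((tilde.toOpen M ⊤).hom.map_smul f m).symm
  rw [← hψf]
  change ((tilde.functor R).map ψ).app U x = _
  rw [hψ]
  rfl

/-- Two `R`-linear maps inverse to each other up to `f` become isomorphisms inside `D(f)`. -/
theorem tilde.isIso_restrict_map {M N : ModuleCat.{0} R} {f : R} {U : (Spec R).Opens}
    (hU : U ≤ PrimeSpectrum.basicOpen f) (g : M ⟶ N) (h : N ⟶ M)
    (hgh : g ≫ h = f • 𝟙 M) (hhg : h ≫ g = f • 𝟙 N) :
    IsIso ((Scheme.Modules.restrictFunctor U.ι).map (tilde.map g)) := by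
  rw [Scheme.Modules.Hom.isIso_iff_isIso_app]
  intro V
  have hV : U.ι ''ᵁ V ≤ PrimeSpectrum.basicOpen f :=
    ((U.ι.image_mono le_top).trans (by simp)).trans hU
  have key : ∀ {A B : ModuleCat.{0} R} (a : A ⟶ B) (b : B ⟶ A), a ≫ b = f • 𝟙 A →
      ∀ x, (tilde.map b).app (U.ι ''ᵁ V) ((tilde.map a).app (U.ι ''ᵁ V) x) = f • x := by
    intro A B a b hab x
    rw [← tilde.map_smul_id_app_apply, ← hab, tilde.map_comp]
    rfl
  -- Inside `D(f)`, the element `f` acts invertibly on sections.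
  have hu : ∀ A : ModuleCat.{0} R,
      Function.Bijective fun x : Scheme.Modules.presheaf (tilde A) |>.obj (.op (U.ι ''ᵁ V)) =>
        f • x :=
    fun A => (Module.End.isUnit_iff _).mp
      (Scheme.Modules.isUnit_algebraMap_end_of_le_basicOpen f hV)
  change IsIso ((tilde.map g).app (U.ι ''ᵁ V))
  rw [ConcreteCategory.isIso_iff_bijective]
  refine ⟨fun x y hxy => (hu M).1 ?_, fun y => ?_⟩
  · simp only
    rw [← key g h hgh, ← key g h hgh, hxy]
  · obtain ⟨z, rfl⟩ := (hu N).2 y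
    exact ⟨_, key h g hhg z⟩

/-- The sheaf associated to `R^n` is `𝒪^n`. -/
noncomputable def tildePiIso (n : ℕ) :
    tilde (ModuleCat.of R (Fin n → R)) ≅ freeModule (Spec R) n :=
  (tilde.functor R).mapIso (Finsupp.linearEquivFunOnFinite R R (Fin n)).symm.toModuleIso ≪≫
    tildeFinsupp (Fin n)

/-- The restriction of `𝒪^n` is `𝒪^n`. -/
noncomputable def restrictFreeModule {Y : Scheme.{0}} (U : Y.Opens) (n : ℕ) :
    (freeModule Y n).restrict U.ι ≅ freeModule U n :=
  (Scheme.Modules.restrictFunctorIsoPullback U.ι).app _ ≪≫ pullbackFreeModule U.ι n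

theorem nonempty_restrict_tilde_iso_freeModule {N : ModuleCat.{0} R} {n : ℕ} {f : R}
    {U : (Spec R).Opens} (hU : U ≤ PrimeSpectrum.basicOpen f)
    (g : (Fin n → R) →ₗ[R] N) (h : N →ₗ[R] (Fin n → R)) (hgh : ∀ v, h (g v) = f • v)
    (hhg : ∀ x, g (h x) = f • x) :
    Nonempty ((tilde N).restrict U.ι ≅ freeModule U n) := by
  have := tilde.isIso_restrict_map hU (M := .of R (Fin n → R)) (ModuleCat.ofHom g)
    (ModuleCat.ofHom h) (by ext1; exact LinearMap.ext hgh) (by ext1; exact LinearMap.ext hhg)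
  exact ⟨(asIso ((Scheme.Modules.restrictFunctor _).map
    (tilde.map (ModuleCat.ofHom g)))).symm ≪≫
    (Scheme.Modules.restrictFunctor _).mapIso (tildePiIso n) ≪≫ restrictFreeModule _ n⟩

theorem freeModule_isVectorBundle (n : ℕ) (Y : Scheme.{0}) :
    IsVectorBundle n Y (freeModule Y n) :=
  fun _ => ⟨⊤, trivial, ⟨restrictFreeModule ⊤ n⟩⟩

theorem nonempty_linearEquiv_of_tilde_iso_freeModule {N : ModuleCat.{0} R} {n : ℕ}
    (e : tilde N ≅ freeModule (Spec R) n) : Nonempty ((Fin n → R) ≃ₗ[R] N) :=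
  ⟨(tilde.fullyFaithfulFunctor.preimageIso (X := .of R (Fin n → R)) (Y := N)
    (tildePiIso n ≪≫ e.symm)).toLinearEquiv⟩

end AlgebraicGeometry

/-- For every field `K` and `n ≥ 1` there is an affine scheme over `K` with a nontrivial vector
bundle of rank `n`. -/
theorem exists_nontrivial_vectorBundle (K : Type) [Field K] {n : ℕ} (hn : 1 ≤ n) :
    ∃ (U : Scheme.{0}) (_ : U ⟶ Spec (.of K)) (E : VectBundle n U),
      IsEmpty (E.obj ≅ freeModule U n) := by
  obtain ⟨R, _, _, _, I, J, c, hc, hIJ, hI⟩ := exists_not_isPrincipal_and_mul_eq_span K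
  obtain ⟨k, rfl⟩ := Nat.exists_eq_add_of_le' hn
  let N : ModuleCat.{0} (CommRingCat.of R) := ModuleCat.of R (I × (Fin k → R))
  refine ⟨Spec (.of R), Spec.map (CommRingCat.ofHom (algebraMap K R)), ⟨tilde N, fun y => ?_⟩,
    ⟨fun e => ?_⟩⟩
  · obtain ⟨f, hf, g, h, hgh, hhg⟩ := Ideal.exists_almost_inverse_of_mul_eq_span hc hIJ
      y.asIdeal y.isPrime.ne_top
    refine ⟨PrimeSpectrum.basicOpen f, hf, nonempty_restrict_tilde_iso_freeModule
      (R := .of R) (N := N) le_rfl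
      -- The factor `f` on `R^k` makes both composites equal to `f` on every coordinate.
      ((g.prodMap (f • LinearMap.id)) ∘ₗ (Fin.consLinearEquiv R fun _ => R).symm.toLinearMap)
      ((Fin.consLinearEquiv R fun _ => R).toLinearMap ∘ₗ (h.prodMap LinearMap.id)) ?_ ?_⟩
    · intro v
      refine funext (Fin.cases ?_ fun i => ?_)
      · exact hgh (v 0)
      · rfl
    · rintro ⟨x, v⟩
      exact Prod.ext (hhg x) rfl
  · obtain ⟨e'⟩ := nonempty_linearEquiv_of_tilde_iso_freeModule (R := .of R) e
    exact hI (Ideal.isPrincipal_of_prod_equiv I e')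

/-! ### Representability forces bundles on schemes over `X` to be trivial. -/

/-- The trivial vector bundle of rank `n`. -/
noncomputable def VectBundle.free (n : ℕ) (Y : Scheme.{0}) : VectBundle n Y :=
  ⟨freeModule Y n, freeModule_isVectorBundle n Y⟩

/-- The isomorphism class of a vector bundle. -/
noncomputable def VectBundle.isoClass {n : ℕ} {Y : Scheme.{0}} (E : VectBundle n Y) :
    (vectBundleClasses n).obj (.op Y) :=
  Quotient.mk (isIsomorphicSetoid (VectBundle n Y)) E

theorem VectBundle.isoClass_eq_free_iff {n : ℕ} {Y : Scheme.{0}} {E : VectBundle n Y} :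
    E.isoClass = (VectBundle.free n Y).isoClass ↔ Nonempty (E.obj ≅ freeModule Y n) := by
  refine Quotient.eq.trans ⟨fun ⟨e⟩ => ⟨(IsVectorBundle n Y).ι.mapIso e⟩, fun ⟨e⟩ => ?_⟩
  exact ⟨ObjectProperty.isoMk _ e⟩

theorem vectBundleClasses_map_free {n : ℕ} {Y Z : Scheme.{0}} (f : Y ⟶ Z) :
    (vectBundleClasses n).map f.op (VectBundle.free n Z).isoClass =
      (VectBundle.free n Y).isoClass :=
  VectBundle.isoClass_eq_free_iff.mpr ⟨pullbackFreeModule f n⟩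

theorem vectBundleClasses_map_ι_eq_free {n : ℕ} {Y : Scheme.{0}} {E : VectBundle n Y}
    {U : Y.Opens} (e : E.obj.restrict U.ι ≅ freeModule U n) :
    (vectBundleClasses n).map U.ι.op E.isoClass = (VectBundle.free n U).isoClass :=
  VectBundle.isoClass_eq_free_iff.mpr
    ⟨((Scheme.Modules.restrictFunctorIsoPullback U.ι).app E.obj).symm ≪≫ e⟩

/-- The projection `U ×_ℂ X ⟶ U`, as a natural transformation. -/
noncomputable def prodWithFst (X : SchC) : prodWith X ⟶ Over.forget _ where
  app U := Limits.pullback.fst U.hom X.hom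
  naturality _ _ _ := Limits.pullback.lift_fst _ _ _

/-- The graph of a morphism `U ⟶ X`. -/
noncomputable def prodWithGraph {X U : SchC} (s : U ⟶ X) : U.left ⟶ (prodWith X).obj U :=
  Limits.pullback.lift (𝟙 _) s.left (by simp)

theorem prodWithGraph_fst {X U : SchC} (s : U ⟶ X) :
    prodWithGraph s ≫ (prodWithFst X).app U = 𝟙 U.left :=
  Limits.pullback.lift_fst _ _ _

/-- The pullback of vector bundles on `U` to `U ×_ℂ X`. -/
noncomputable def pullbackToProd (X : SchC) (n : ℕ) :
    (Over.forget _).op ⋙ vectBundleClasses n ⟶ moduliFunctor X n :=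
  Functor.whiskerRight (NatTrans.op (prodWithFst X)) (vectBundleClasses n)

/-- The graph of `s` is a section of the projection, so pulling back along it undoes
`pullbackToProd`. -/
theorem pullbackToProd_injective {X U : SchC} (s : U ⟶ X) (n : ℕ) :
    Function.Injective ((pullbackToProd X n).app (.op U)) := by
  have h : (pullbackToProd X n).app (.op U) ≫ (vectBundleClasses n).map (prodWithGraph s).op =
      𝟙 _ := by
    refine ((vectBundleClasses n).map_comp _ _).symm.trans ?_
    rw [NatTrans.op_app, ← op_comp, prodWithGraph_fst]
    exact (vectBundleClasses n).map_id _
  exact Function.LeftInverse.injective (g := (vectBundleClasses n).map (prodWithGraph s).op)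
    fun c => ConcreteCategory.congr_hom h c

/-- If the moduli functor is representable, all vector bundles on a scheme over `X` are
trivial. -/
theorem nonempty_iso_freeModule_of_representableBy {X M : SchC} {n : ℕ}
    (hM : (moduliFunctor X n).RepresentableBy M) {U : SchC} (s : U ⟶ X)
    (E : VectBundle n U.left) : Nonempty (E.obj ≅ freeModule U.left n) := by
  let τ := pullbackToProd X n
  let a (F : VectBundle n U.left) : U ⟶ M := hM.homEquiv.symm (τ.app (.op U) F.isoClass)
  have hres (W : U.left.Opens) (e : Nonempty (E.obj.restrict W.ι ≅ freeModule W n)) :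
      W.ι ≫ (a E).left = W.ι ≫ (a (VectBundle.free n U.left)).left := by
    let j : Over.mk (W.ι ≫ U.hom) ⟶ U := Over.homMk W.ι
    suffices h : j ≫ a E = j ≫ a (VectBundle.free n U.left) from congr_arg (fun φ => φ.left) h
    apply hM.homEquiv.injective
    have hj (F : VectBundle n U.left) : hM.homEquiv (j ≫ a F) =
        τ.app (.op (Over.mk (W.ι ≫ U.hom))) ((vectBundleClasses n).map W.ι.op F.isoClass) := by
      rw [hM.comp_homEquiv_symm, Equiv.apply_symm_apply]
      exact (ConcreteCategory.congr_hom (τ.naturality j.op) F.isoClass).symm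
    rw [hj, hj, vectBundleClasses_map_ι_eq_free e.some, vectBundleClasses_map_free]
  choose V hV e using E.property
  -- The opens trivializing `E` cover `U`, and morphisms that agree on an open cover are equal.
  have ha : a E = a (VectBundle.free n U.left) :=
    Over.OverMorphism.ext ((Scheme.openCoverOfIsOpenCover _ V (top_le_iff.mp fun y _ =>
      TopologicalSpace.Opens.mem_iSup.mpr ⟨y, hV y⟩)).hom_ext _ _ fun y => hres (V y) (e y))
  exact VectBundle.isoClass_eq_free_iff.mp
    (pullbackToProd_injective s n (hM.homEquiv.symm.injective ha))

theorem mainTheorem2 (X : SchC) (hX : IsSmoothProjectiveCurve X) (n : ℕ) (hn : 1 ≤ n) :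
    ¬ ∃ M : SchC, Nonempty ((moduliFunctor X n).RepresentableBy M) := by
  rintro ⟨M, ⟨hM⟩⟩
  obtain ⟨x⟩ := hX.nonempty
  obtain ⟨U, q, E, hE⟩ := exists_nontrivial_vectorBundle (X.left.residueField x) hn
  let s : U ⟶ X.left := q ≫ X.left.fromSpecResidueField x
  -- `U` gets its `ℂ`-structure through `s`, so that `s` is a morphism over `ℂ`.
  obtain ⟨e⟩ := nonempty_iso_freeModule_of_representableBy hM
    (Over.homMk s : Over.mk (s ≫ X.hom) ⟶ X) E
  exact hE.false e
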